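/- Let $A \in \{0,1\}^{n \times n}$ be a symmetric matrix with zero diagonal. Its bipartite graph has two disjoint copies of $\{1,\dots,n\}$ as its node sets, with node $i$ of the first joined to node $j$ of the second if and only if $A_{ij} > 0$. Suppose that $A$ has support, i.e. this bipartite graph has a perfect matching. Let $A_M$ be the matrix obtained from $A$ by replacing by $0$ every entry that does not lie on any perfect matching of the bipartite graph, and suppose that the graph $G(A_M)$ on $\{1,\dots,n\}$, with an edge between $i \neq j$ if and only if $(A_M)_{ij} \neq 0$, is connected. Then the Sinkhorn–Knopp iteration started at $A$, which alternately scales all rows and all columns to have unit sum, converges to a doubly stochastic matrix $SK(A)$, and the matrices $W = Z = 2(I - SK(A))$ are symmetric positive semidefinite and satisfy \[ Z \succeq W, \qquad \operatorname{null}(W) = \operatorname{span}(\mathbf 1), \qquad \operatorname{diag}(Z) = 2\cdot\mathbf 1, \qquad \mathbf 1^T Z \mathbf 1 = 0, \] where $Z \succeq W$ means that $Z - W$ is symmetric positive semidefinite and $\mathbf 1$ is the all-ones vector. Moreover, $Z$ and $W$ adhere to the sparsity structure of $G(A)$: $Z_{ij} = W_{ij} = 0$ for all $i \neq j$ with $A_{ij}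 = 0$. -/

import Mathlib

open Filter Topology

noncomputable section

namespace SinkhornSplitting

variable {n : ℕ}

/-- The bipartite graph with biadjacency matrix `A`: node `i` of the first copy of `Fin n` and
node `j` of the second copy are joined by an edge iff `A i j > 0`. -/
def bipartiteGraph (A : Matrix (Fin n) (Fin n) ℝ) : SimpleGraph (Fin n ⊕ Fin n) :=
  SimpleGraph.fromRel fun u v => ∃ i j, u = Sum.inl i ∧ v = Sum.inr j ∧ 0 < A i j

/-- `A` has support: its bipartite graph has a perfect matching. -/
def HasSupport (A : Matrix (Fin n) (Fin n) ℝ) : Prop :=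
  ∃ M : (bipartiteGraph A).Subgraph, M.IsPerfectMatching

open Classical in
/-- The matrix `A_M`: the entries of `A` that lie on some perfect matching of the bipartite graph
of `A` are kept, all others are replaced by zero. -/
def matchingPart (A : Matrix (Fin n) (Fin n) ℝ) : Matrix (Fin n) (Fin n) ℝ :=
  Matrix.of fun i j =>
    if ∃ M : (bipartiteGraph A).Subgraph, M.IsPerfectMatching ∧ M.Adj (Sum.inl i) (Sum.inr j)
    then A i j else 0

/-- The (unweighted, undirected) graph `G(B)` on `Fin n` of an adjacency matrix `B`: distinct
nodes `i`, `j` are adjacent iff `B i j ≠ 0` (or `B j i ≠ 0`, which is the same for symmetric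
`B`). -/
def matrixGraph (B : Matrix (Fin n) (Fin n) ℝ) : SimpleGraph (Fin n) :=
  SimpleGraph.fromRel fun i j => B i j ≠ 0

/-- Scale every row to have unit sum. -/
def rowScale (B : Matrix (Fin n) (Fin n) ℝ) : Matrix (Fin n) (Fin n) ℝ :=
  Matrix.of fun i j => B i j / ∑ k, B i k

/-- Scale every column to have unit sum. -/
def colScale (B : Matrix (Fin n) (Fin n) ℝ) : Matrix (Fin n) (Fin n) ℝ :=
  Matrix.of fun i j => B i j / ∑ k, B k j

/-- The iterates of the Sinkhorn-Knopp algorithm started at `A`: alternately the rows and the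
columns are scaled to unit sum, beginning with the rows. Every half step is recorded. -/
def sinkhornSeq (A : Matrix (Fin n) (Fin n) ℝ) : ℕ → Matrix (Fin n) (Fin n) ℝ
  | 0 => A
  | k + 1 => if Even k then rowScale (sinkhornSeq A k) else colScale (sinkhornSeq A k)

/-- `SK(A)`, the limit of the Sinkhorn-Knopp iterates (meaningful only when they converge). -/
def SK (A : Matrix (Fin n) (Fin n) ℝ) : Matrix (Fin n) (Fin n) ℝ :=
  limUnder atTop (sinkhornSeq A)

/-- The conditions on the matrix parameters `Z`, `W` of the splitting method. -/
structure SplittingConditions (Z W : Matrix (Fin n) (Fin n) ℝ) : Prop where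
  /-- `Z` is symmetric positive semidefinite. -/
  posSemidef_Z : Z.PosSemidef
  /-- `W` is symmetric positive semidefinite. -/
  posSemidef_W : W.PosSemidef
  /-- `Z ⪰ W`. -/
  posSemidef_sub : (Z - W).PosSemidef
  /-- The null space of `W` is the span of the ones vector. -/
  ker_W : LinearMap.ker W.mulVecLin = Submodule.span ℝ {(1 : Fin n → ℝ)}
  /-- Every diagonal entry of `Z` is `2`. -/
  diag_Z : ∀ i, Z i i = 2
  /-- `1ᵀ Z 1 = 0`. -/
  sum_Z : (1 : Fin n → ℝ) ⬝ᵥ Z.mulVec 1 = 0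

/-- `Z` and `W` adhere to the sparsity structure of `G(A)`: both vanish at every pair of distinct
nodes that are not joined by an edge. -/
def Adheres (A Z W : Matrix (Fin n) (Fin n) ℝ) : Prop :=
  ∀ i j, i ≠ j → A i j = 0 → Z i j = 0 ∧ W i j = 0

end SinkhornSplitting

end

/-!
Write `B k` for the Sinkhorn-Knopp iterates. Along a perfect matching `σ` of the bipartite graph,
a scaling step divides the product `∏ i, B k i (σ i)` by the product of all the row (or column)
sums. From the first step on these sums have mean `1`, so by the inequality of arithmetic and
geometric means the product does not decrease, and it is at most `1`. Its convergence, with the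
quantitative inequality `sum_sqrt_sub_one_sq_le`, forces all row and column sums of `B k` to tend
to `1` (`tendsto_scaleSum`), so every limit point is doubly stochastic. A limit point is positive
on every perfect matching, because the products are bounded below (`IsLimitPoint.pos`), and by
Birkhoff's theorem it vanishes off the perfect matchings. So its zero pattern is that of the
matching part of `A` (`IsLimitPoint.ne_zero_iff`).

Scaling adds to `log (B k i j)` a function of `i` or of `j` alone. Hence for a matrix `D` with zero
row and column sums that vanishes off the matching part, `∑ D i j * log (B k i j)` does not depend
on `k`, and a limit point `L` satisfies `∑ D i j * log (L i j) = ∑ D i j * log (A i j)`. For two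
limit points `L` and `M`, the choice `D = L - M` gives
`∑ (L i j - M i j) * (log (L i j) - log (M i j)) = 0`, and strict monotonicity of the logarithm
yields `L = M`. As the iterates stay in a compact set, they converge. The same argument with
`D = L - Lᵀ` shows that the limit is symmetric when `A` is.

For a symmetric doubly stochastic matrix `S`, the quadratic form of `2 • (1 - S)` is
`∑ S i j * (x i - x j) ^ 2`. This gives semidefiniteness, and the null space is the span of the
all-ones vector as soon as the graph of `S` is connected; for `S = SK A` that graph is the graph of
the matching part.
-/

namespace SinkhornSplitting

variable {n : ℕ}

/-! ### Perfect matchings as permutations -/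

/-- `σ` is a perfect matching of the bipartite graph of `A`, encoded as a permutation: row `i` is
matched with column `σ i`. -/
def IsMatchingPerm (A : Matrix (Fin n) (Fin n) ℝ) (σ : Equiv.Perm (Fin n)) : Prop :=
  ∀ i, 0 < A i (σ i)

lemma bipartiteGraph_adj_inl {A : Matrix (Fin n) (Fin n) ℝ} {i : Fin n} {v : Fin n ⊕ Fin n} :
    (bipartiteGraph A).Adj (Sum.inl i) v ↔ ∃ j, v = Sum.inr j ∧ 0 < A i j := by
  simp only [bipartiteGraph, SimpleGraph.fromRel_adj]
  constructor
  · rintro ⟨-, ⟨a, b, h, rfl, hA⟩ | ⟨a, b, -, h, -⟩⟩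
    · cases h
      exact ⟨b, rfl, hA⟩
    · cases h
  · rintro ⟨j, rfl, hA⟩
    exact ⟨Sum.inl_ne_inr, Or.inl ⟨i, j, rfl, rfl, hA⟩⟩

lemma exists_isMatchingPerm_of_isPerfectMatching {A : Matrix (Fin n) (Fin n) ℝ}
    {M : (bipartiteGraph A).Subgraph} (hM : M.IsPerfectMatching) :
    ∃ σ, IsMatchingPerm A σ ∧ ∀ i j, M.Adj (Sum.inl i) (Sum.inr j) → σ i = j := by
  rw [SimpleGraph.Subgraph.isPerfectMatching_iff] at hM
  have h1 : ∀ i, ∃ j, M.Adj (Sum.inl i) (Sum.inr j) ∧ 0 < A i j := by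
    intro i
    obtain ⟨w, hw, -⟩ := hM (Sum.inl i)
    obtain ⟨j, rfl, hj⟩ := bipartiteGraph_adj_inl.1 hw.adj_sub
    exact ⟨j, hw, hj⟩
  choose f hf hA using h1
  have hinj : Function.Injective f := fun a b hab =>
    Sum.inl_injective ((hM (Sum.inr (f a))).unique (hf a).symm (hab ▸ (hf b).symm))
  refine ⟨Equiv.ofBijective f (Finite.injective_iff_bijective.1 hinj), hA, fun i j hij => ?_⟩
  exact Sum.inr_injective ((hM (Sum.inl i)).unique (hf i) hij)

lemma exists_isPerfectMatching_of_isMatchingPerm {A : Matrix (Fin n) (Fin n) ℝ}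
    {σ : Equiv.Perm (Fin n)} (hσ : IsMatchingPerm A σ) :
    ∃ M : (bipartiteGraph A).Subgraph, M.IsPerfectMatching ∧
      ∀ i, M.Adj (Sum.inl i) (Sum.inr (σ i)) := by
  let M : (bipartiteGraph A).Subgraph :=
    { verts := Set.univ
      Adj := fun u v => (∃ i, u = Sum.inl i ∧ v = Sum.inr (σ i)) ∨
        ∃ i, v = Sum.inl i ∧ u = Sum.inr (σ i)
      adj_sub := by
        rintro u v (⟨i, rfl, rfl⟩ | ⟨i, rfl, rfl⟩)
        · exact bipartiteGraph_adj_inl.2 ⟨_, rfl, hσ i⟩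
        · exact (bipartiteGraph_adj_inl.2 ⟨_, rfl, hσ i⟩).symm
      edge_vert := fun _ => Set.mem_univ _
      symm := ⟨fun u v h => h.symm⟩ }
  refine ⟨M, SimpleGraph.Subgraph.isPerfectMatching_iff.2 ?_, fun i => Or.inl ⟨i, rfl, rfl⟩⟩
  rintro (i | j)
  · refine ⟨Sum.inr (σ i), Or.inl ⟨i, rfl, rfl⟩, ?_⟩
    rintro v (⟨a, ha, rfl⟩ | ⟨a, rfl, ha⟩)
    · cases ha
      rfl
    · cases ha
  · refine ⟨Sum.inl (σ.symm j), Or.inr ⟨σ.symm j, rfl, by simp⟩, ?_⟩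
    rintro v (⟨a, ha, rfl⟩ | ⟨a, rfl, ha⟩)
    · cases ha
    · cases ha
      simp

lemma matchingPart_ne_zero_iff {A : Matrix (Fin n) (Fin n) ℝ} {i j : Fin n} :
    matchingPart A i j ≠ 0 ↔ ∃ σ, IsMatchingPerm A σ ∧ σ i = j := by
  simp only [matchingPart, Matrix.of_apply, ne_eq, ite_eq_right_iff, Classical.not_imp]
  constructor
  · rintro ⟨⟨M, hM, hij⟩, -⟩
    obtain ⟨σ, hσ, h⟩ := exists_isMatchingPerm_of_isPerfectMatching hM
    exact ⟨σ, hσ, h i j hij⟩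
  · rintro ⟨σ, hσ, rfl⟩
    obtain ⟨M, hM, h⟩ := exists_isPerfectMatching_of_isMatchingPerm hσ
    exact ⟨⟨M, hM, h i⟩, (hσ i).ne'⟩

/-- A consequence of Birkhoff's theorem: every nonzero entry of a doubly stochastic matrix lies on
a perfect matching of its bipartite graph. -/
lemma exists_isMatchingPerm_of_mem_doublyStochastic {L : Matrix (Fin n) (Fin n) ℝ}
    (hL : L ∈ doublyStochastic ℝ (Fin n)) {i j : Fin n} (hij : L i j ≠ 0) :
    ∃ σ, IsMatchingPerm L σ ∧ σ i = j := by
  obtain ⟨w, hw0, -, rfl⟩ := exists_eq_sum_perm_of_mem_doublyStochastic hL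
  simp only [Matrix.sum_apply, Matrix.smul_apply, smul_eq_mul] at hij
  obtain ⟨σ, -, hσ⟩ := Finset.exists_ne_zero_of_sum_ne_zero hij
  have hσj : σ i = j := by
    by_contra h
    simp [Equiv.Perm.permMatrix, PEquiv.toMatrix_apply, h] at hσ
  refine ⟨σ, fun k => ?_, hσj⟩
  simp only [Matrix.sum_apply, Matrix.smul_apply, smul_eq_mul]
  have hnn : ∀ τ ∈ Finset.univ, 0 ≤ w τ * (Equiv.Perm.permMatrix ℝ τ) k (σ k) := by
    intro τ _
    refine mul_nonneg (hw0 τ) ?_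
    simp only [Equiv.Perm.permMatrix, PEquiv.toMatrix_apply]
    split_ifs <;> norm_num
  refine Finset.sum_pos' hnn ⟨σ, Finset.mem_univ _, ?_⟩
  have : 0 < w σ := lt_of_le_of_ne (hw0 σ) (Ne.symm (left_ne_zero_of_mul hσ))
  simpa [Equiv.Perm.permMatrix, PEquiv.toMatrix_apply] using this

/-! ### One scaling step -/

/-- `B` is entrywise nonnegative with the same zero pattern as `A`. -/
def SamePattern (A B : Matrix (Fin n) (Fin n) ℝ) : Prop :=
  ∀ i j, 0 ≤ B i j ∧ (B i j = 0 ↔ A i j = 0)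

lemma SamePattern.isMatchingPerm {A B : Matrix (Fin n) (Fin n) ℝ} (h : SamePattern A B)
    {σ : Equiv.Perm (Fin n)} (hσ : IsMatchingPerm A σ) : IsMatchingPerm B σ := fun i =>
  lt_of_le_of_ne (h i _).1 fun h0 => (hσ i).ne' ((h i _).2.1 h0.symm)

lemma row_sum_pos {B : Matrix (Fin n) (Fin n) ℝ} (hB : ∀ i j, 0 ≤ B i j)
    {σ : Equiv.Perm (Fin n)} (hσ : IsMatchingPerm B σ) (i : Fin n) : 0 < ∑ j, B i j :=
  Finset.sum_pos' (fun _ _ => hB _ _) ⟨σ i, Finset.mem_univ _, hσ i⟩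

lemma col_sum_pos {B : Matrix (Fin n) (Fin n) ℝ} (hB : ∀ i j, 0 ≤ B i j)
    {σ : Equiv.Perm (Fin n)} (hσ : IsMatchingPerm B σ) (j : Fin n) : 0 < ∑ i, B i j :=
  Finset.sum_pos' (fun _ _ => hB _ _)
    ⟨σ.symm j, Finset.mem_univ _, by simpa using hσ (σ.symm j)⟩

/-- The sums by which the `k`-th step of the Sinkhorn-Knopp iteration divides: the row sums of the
current iterate if `k` is even, its column sums if `k` is odd. -/
noncomputable def scaleSum (A : Matrix (Fin n) (Fin n) ℝ) (k : ℕ) (i : Fin n) : ℝ :=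
  if Even k then ∑ j, sinkhornSeq A k i j else ∑ j, sinkhornSeq A k j i

lemma sinkhornSeq_succ_apply (A : Matrix (Fin n) (Fin n) ℝ) (k : ℕ) (i j : Fin n) :
    sinkhornSeq A (k + 1) i j =
      sinkhornSeq A k i j / scaleSum A k (if Even k then i else j) := by
  by_cases hk : Even k <;> simp [sinkhornSeq, scaleSum, hk, rowScale, colScale]

section Iterates

variable {A : Matrix (Fin n) (Fin n) ℝ} {σ : Equiv.Perm (Fin n)}

lemma scaleSum_pos_of_samePattern (hσ : IsMatchingPerm A σ) {k : ℕ}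
    (h : SamePattern A (sinkhornSeq A k)) (i : Fin n) : 0 < scaleSum A k i := by
  have hm := h.isMatchingPerm hσ
  unfold scaleSum
  split_ifs
  · exact row_sum_pos (fun i j => (h i j).1) hm i
  · exact col_sum_pos (fun i j => (h i j).1) hm i

lemma samePattern_sinkhornSeq (hA : ∀ i j, 0 ≤ A i j) (hσ : IsMatchingPerm A σ) (k : ℕ) :
    SamePattern A (sinkhornSeq A k) := by
  induction k with
  | zero => exact fun i j => ⟨hA i j, Iff.rfl⟩
  | succ k ih =>
    intro i j
    have hs := scaleSum_pos_of_samePattern hσ ih (if Even k then i else j)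
    rw [sinkhornSeq_succ_apply, div_eq_zero_iff, or_iff_left hs.ne']
    exact ⟨div_nonneg (ih i j).1 hs.le, (ih i j).2⟩

lemma scaleSum_pos (hA : ∀ i j, 0 ≤ A i j) (hσ : IsMatchingPerm A σ) (k : ℕ) (i : Fin n) :
    0 < scaleSum A k i :=
  scaleSum_pos_of_samePattern hσ (samePattern_sinkhornSeq hA hσ k) i

lemma log_sinkhornSeq_succ (hA : ∀ i j, 0 ≤ A i j) (hσ : IsMatchingPerm A σ) (k : ℕ)
    {i j : Fin n} (hij : A i j ≠ 0) :
    Real.log (sinkhornSeq A (k + 1) i j) =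
      Real.log (sinkhornSeq A k i j) - Real.log (scaleSum A k (if Even k then i else j)) := by
  rw [sinkhornSeq_succ_apply, Real.log_div _ (scaleSum_pos hA hσ k _).ne']
  exact fun h => hij ((samePattern_sinkhornSeq hA hσ k i j).2.1 h)

lemma row_sum_of_even (hA : ∀ i j, 0 ≤ A i j) (hσ : IsMatchingPerm A σ) {k : ℕ} (hk : Even k)
    (i : Fin n) : ∑ j, sinkhornSeq A (k + 1) i j = 1 := by
  have h := (scaleSum_pos hA hσ k i).ne'
  simp only [sinkhornSeq_succ_apply, if_pos hk, ← Finset.sum_div]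
  rw [div_eq_one_iff_eq h, scaleSum, if_pos hk]

lemma col_sum_of_odd (hA : ∀ i j, 0 ≤ A i j) (hσ : IsMatchingPerm A σ) {k : ℕ} (hk : ¬ Even k)
    (j : Fin n) : ∑ i, sinkhornSeq A (k + 1) i j = 1 := by
  have h := (scaleSum_pos hA hσ k j).ne'
  simp only [sinkhornSeq_succ_apply, if_neg hk, ← Finset.sum_div]
  rw [div_eq_one_iff_eq h, scaleSum, if_neg hk]

lemma sum_scaleSum_succ (hA : ∀ i j, 0 ≤ A i j) (hσ : IsMatchingPerm A σ) (k : ℕ) :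
    ∑ i, scaleSum A (k + 1) i = n := by
  by_cases hk : Even k
  · simp only [scaleSum, if_neg (Nat.even_add_one.not.2 (not_not.2 hk))]
    rw [Finset.sum_comm]
    simp [row_sum_of_even hA hσ hk]
  · simp only [scaleSum, if_pos (Nat.even_add_one.2 hk)]
    refine Finset.sum_comm.trans ?_
    simp [col_sum_of_odd hA hσ hk]

lemma sinkhornSeq_succ_le_one (hA : ∀ i j, 0 ≤ A i j) (hσ : IsMatchingPerm A σ) (k : ℕ)
    (i j : Fin n) : sinkhornSeq A (k + 1) i j ≤ 1 := by
  have hnn := fun a b => (samePattern_sinkhornSeq hA hσ (k + 1) a b).1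
  by_cases hk : Even k
  · rw [← row_sum_of_even hA hσ hk i]
    exact Finset.single_le_sum (f := fun b => sinkhornSeq A (k + 1) i b)
      (fun b _ => hnn i b) (Finset.mem_univ j)
  · rw [← col_sum_of_odd hA hσ hk j]
    exact Finset.single_le_sum (f := fun a => sinkhornSeq A (k + 1) a j)
      (fun a _ => hnn a j) (Finset.mem_univ i)

/-! ### The product along a perfect matching as a Lyapunov function -/

/-- The logarithm of the product of the entries of the `k`-th iterate along the perfect matching
`σ`. -/
noncomputable def logMatchingProd (A : Matrix (Fin n) (Fin n) ℝ) (σ : Equiv.Perm (Fin n))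
    (k : ℕ) : ℝ :=
  ∑ i, Real.log (sinkhornSeq A k i (σ i))

lemma logMatchingProd_succ (hA : ∀ i j, 0 ≤ A i j) (hσ : IsMatchingPerm A σ) (k : ℕ) :
    logMatchingProd A σ (k + 1) = logMatchingProd A σ k - ∑ i, Real.log (scaleSum A k i) := by
  unfold logMatchingProd
  rw [Finset.sum_congr rfl fun i _ => log_sinkhornSeq_succ hA hσ k (hσ i).ne',
    Finset.sum_sub_distrib]
  congr 1
  by_cases hk : Even k
  · simp [hk]
  · simpa [hk] using Equiv.sum_comp σ fun i => Real.log (scaleSum A k i)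

/-- A quantitative form of the inequality of arithmetic and geometric means for numbers of
mean `1`. -/
lemma sum_sqrt_sub_one_sq_le {r : Fin n → ℝ} (hr : ∀ i, 0 < r i) (hsum : ∑ i, r i = n) :
    ∑ i, (√(r i) - 1) ^ 2 ≤ -∑ i, Real.log (r i) := by
  have h : ∀ i, (√(r i) - 1) ^ 2 ≤ r i - 1 - Real.log (r i) := by
    intro i
    -- `log r = 2 log √r ≤ 2 (√r - 1)`, and `r - 1 - 2 (√r - 1) = (√r - 1) ^ 2`.
    have h1 := Real.log_le_sub_one_of_pos (Real.sqrt_pos.2 (hr i))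
    rw [Real.log_sqrt (hr i).le] at h1
    nlinarith [Real.sq_sqrt (hr i).le]
  calc _ ≤ ∑ i, (r i - 1 - Real.log (r i)) := Finset.sum_le_sum fun i _ => h i
    _ = _ := by simp [Finset.sum_sub_distrib, hsum]

lemma sum_sqrt_scaleSum_le (hA : ∀ i j, 0 ≤ A i j) (hσ : IsMatchingPerm A σ) (k : ℕ) :
    ∑ i, (√(scaleSum A (k + 1) i) - 1) ^ 2 ≤
      logMatchingProd A σ (k + 1 + 1) - logMatchingProd A σ (k + 1) := by
  have := sum_sqrt_sub_one_sq_le (scaleSum_pos hA hσ (k + 1)) (sum_scaleSum_succ hA hσ k)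
  rw [logMatchingProd_succ hA hσ (k + 1)]
  linarith

lemma monotone_logMatchingProd (hA : ∀ i j, 0 ≤ A i j) (hσ : IsMatchingPerm A σ) :
    Monotone fun k => logMatchingProd A σ (k + 1) :=
  monotone_nat_of_le_succ fun k => sub_nonneg.1 <|
    (Finset.sum_nonneg fun _ _ => sq_nonneg _).trans (sum_sqrt_scaleSum_le hA hσ k)

lemma log_sinkhornSeq_succ_nonpos (hA : ∀ i j, 0 ≤ A i j) (hσ : IsMatchingPerm A σ) (k : ℕ)
    (i j : Fin n) : Real.log (sinkhornSeq A (k + 1) i j) ≤ 0 :=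
  Real.log_nonpos (samePattern_sinkhornSeq hA hσ _ i j).1 (sinkhornSeq_succ_le_one hA hσ k i j)

/-- The bounded monotone sequence `logMatchingProd A σ` has increments tending to zero, and these
dominate the squares `(√s - 1) ^ 2` of the deviations of the scaling sums. -/
lemma tendsto_scaleSum (hA : ∀ i j, 0 ≤ A i j) (hσ : IsMatchingPerm A σ) (i : Fin n) :
    Tendsto (fun k => scaleSum A k i) atTop (𝓝 1) := by
  have hbdd : BddAbove (Set.range fun k => logMatchingProd A σ (k + 1)) := by
    refine ⟨0, ?_⟩
    rintro _ ⟨k, rfl⟩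
    exact Finset.sum_nonpos fun i _ => log_sinkhornSeq_succ_nonpos hA hσ k i _
  have hlim := tendsto_atTop_ciSup (monotone_logMatchingProd hA hσ) hbdd
  have hdiff := (hlim.comp (tendsto_add_atTop_nat 1)).sub hlim
  rw [sub_self] at hdiff
  have hsq : Tendsto (fun k => (√(scaleSum A (k + 1) i) - 1) ^ 2) atTop (𝓝 0) :=
    squeeze_zero (fun _ => sq_nonneg _) (fun k =>
      (Finset.single_le_sum (f := fun i => (√(scaleSum A (k + 1) i) - 1) ^ 2)
        (fun _ _ => sq_nonneg _) (Finset.mem_univ i)).trans (sum_sqrt_scaleSum_le hA hσ k)) hdiff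
  have h0 : Tendsto (fun k => √(scaleSum A (k + 1) i) - 1) atTop (𝓝 0) := by
    rw [tendsto_zero_iff_abs_tendsto_zero]
    simpa [Real.sqrt_sq_eq_abs, Function.comp_def] using hsq.sqrt
  have h1 := (h0.add_const 1).pow 2
  rw [← tendsto_add_atTop_iff_nat 1]
  simpa [Real.sq_sqrt (scaleSum_pos hA hσ _ i).le] using h1

lemma tendsto_row_sum (hA : ∀ i j, 0 ≤ A i j) (hσ : IsMatchingPerm A σ) (i : Fin n) :
    Tendsto (fun k => ∑ j, sinkhornSeq A k i j) atTop (𝓝 1) := by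
  rw [← tendsto_add_atTop_iff_nat 1]
  have h := (tendsto_add_atTop_iff_nat 1).2 (tendsto_scaleSum hA hσ i)
  refine (h.if' (p := fun k => ¬ Even k) tendsto_const_nhds).congr fun k => ?_
  by_cases hk : Even k
  · simp [hk, row_sum_of_even hA hσ hk i]
  · simp [hk, scaleSum, Nat.even_add_one]

lemma tendsto_col_sum (hA : ∀ i j, 0 ≤ A i j) (hσ : IsMatchingPerm A σ) (j : Fin n) :
    Tendsto (fun k => ∑ i, sinkhornSeq A k i j) atTop (𝓝 1) := by
  rw [← tendsto_add_atTop_iff_nat 1]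
  have h := (tendsto_add_atTop_iff_nat 1).2 (tendsto_scaleSum hA hσ j)
  refine (h.if' (p := fun k => Even k) tendsto_const_nhds).congr fun k => ?_
  by_cases hk : Even k
  · simp [hk, scaleSum, Nat.even_add_one]
  · simp [hk, col_sum_of_odd hA hσ hk j]

/-! ### Limit points of the iteration -/

/-- `L` is the limit of the Sinkhorn-Knopp iterates along some nontrivial filter `f ≤ atTop`. -/
def IsLimitPoint (A L : Matrix (Fin n) (Fin n) ℝ) : Prop :=
  ∃ f : Filter ℕ, f.NeBot ∧ f ≤ atTop ∧ Tendsto (sinkhornSeq A) f (𝓝 L)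

lemma tendsto_entry {f : Filter ℕ} {L : Matrix (Fin n) (Fin n) ℝ}
    (h : Tendsto (sinkhornSeq A) f (𝓝 L)) (i j : Fin n) :
    Tendsto (fun k => sinkhornSeq A k i j) f (𝓝 (L i j)) :=
  (tendsto_pi_nhds.1 (tendsto_pi_nhds.1 h i) j)

lemma IsLimitPoint.mem_doublyStochastic {L : Matrix (Fin n) (Fin n) ℝ} (hL : IsLimitPoint A L)
    (hA : ∀ i j, 0 ≤ A i j) (hσ : IsMatchingPerm A σ) : L ∈ doublyStochastic ℝ (Fin n) := by
  obtain ⟨f, hf, hle, h⟩ := hL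
  rw [mem_doublyStochastic_iff_sum]
  refine ⟨fun i j => ?_, fun i => ?_, fun j => ?_⟩
  · exact ge_of_tendsto' (tendsto_entry h i j) fun k => (samePattern_sinkhornSeq hA hσ k i j).1
  · exact tendsto_nhds_unique (tendsto_finsetSum _ fun j _ => tendsto_entry h i j)
      ((tendsto_row_sum hA hσ i).mono_left hle)
  · exact tendsto_nhds_unique (tendsto_finsetSum _ fun i _ => tendsto_entry h i j)
      ((tendsto_col_sum hA hσ j).mono_left hle)

lemma IsLimitPoint.eq_zero {L : Matrix (Fin n) (Fin n) ℝ} (hL : IsLimitPoint A L)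
    (hA : ∀ i j, 0 ≤ A i j) (hσ : IsMatchingPerm A σ) {i j : Fin n} (hij : A i j = 0) :
    L i j = 0 := by
  obtain ⟨f, hf, hle, h⟩ := hL
  refine tendsto_nhds_unique (tendsto_entry h i j) ?_
  simp [(samePattern_sinkhornSeq hA hσ _ i j).2.2 hij]

/-- Entries on a perfect matching stay bounded away from zero: all factors of the nondecreasing
product along the matching are at most `1`. -/
lemma IsLimitPoint.pos {L : Matrix (Fin n) (Fin n) ℝ} (hL : IsLimitPoint A L)
    (hA : ∀ i j, 0 ≤ A i j) (hσ : IsMatchingPerm A σ) (i : Fin n) : 0 < L i (σ i) := by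
  obtain ⟨f, hf, hle, h⟩ := hL
  refine (Real.exp_pos (logMatchingProd A σ 1)).trans_le
    (ge_of_tendsto (tendsto_entry h i (σ i)) (hle ?_))
  filter_upwards [eventually_ge_atTop 1] with k hk
  obtain ⟨k, rfl⟩ := Nat.exists_eq_add_of_le' hk
  have hpos := (samePattern_sinkhornSeq hA hσ (k + 1)).isMatchingPerm hσ i
  rw [← Real.le_log_iff_exp_le hpos]
  refine (monotone_logMatchingProd hA hσ (Nat.zero_le k)).trans ?_
  simp only [logMatchingProd]
  rw [← Finset.add_sum_erase _ _ (Finset.mem_univ i)]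
  exact add_le_of_nonpos_right
    (Finset.sum_nonpos fun _ _ => log_sinkhornSeq_succ_nonpos hA hσ k _ _)

/-- Every limit point has exactly the zero pattern of the matching part of `A`. -/
lemma IsLimitPoint.ne_zero_iff {L : Matrix (Fin n) (Fin n) ℝ} (hL : IsLimitPoint A L)
    (hA : ∀ i j, 0 ≤ A i j) (hσ : IsMatchingPerm A σ) {i j : Fin n} :
    L i j ≠ 0 ↔ ∃ τ, IsMatchingPerm A τ ∧ τ i = j := by
  constructor
  · intro h
    obtain ⟨τ, hτ, hij⟩ :=
      exists_isMatchingPerm_of_mem_doublyStochastic (hL.mem_doublyStochastic hA hσ) h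
    refine ⟨τ, fun k => lt_of_le_of_ne (hA _ _) fun h0 => ?_, hij⟩
    exact (hτ k).ne' (hL.eq_zero hA hσ h0.symm)
  · rintro ⟨τ, hτ, rfl⟩
    exact (hL.pos hA hτ i).ne'

/-- Scaling rows or columns changes `log B i j` by a function of `i` or of `j` alone, so pairings
with matrices `D` of zero row and column sums are preserved. Where `A` vanishes the logarithm has
a junk value, which `D i j = 0` discards. -/
lemma sum_mul_log_sinkhornSeq (hA : ∀ i j, 0 ≤ A i j) (hσ : IsMatchingPerm A σ)
    {D : Matrix (Fin n) (Fin n) ℝ} (hD : ∀ i j, A i j = 0 → D i j = 0)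
    (hrow : ∀ i, ∑ j, D i j = 0) (hcol : ∀ j, ∑ i, D i j = 0) (k : ℕ) :
    ∑ i, ∑ j, D i j * Real.log (sinkhornSeq A k i j) = ∑ i, ∑ j, D i j * Real.log (A i j) := by
  induction k with
  | zero => rfl
  | succ k ih =>
    have h : ∀ i j, D i j * Real.log (sinkhornSeq A (k + 1) i j) =
        D i j * Real.log (sinkhornSeq A k i j) -
          D i j * Real.log (scaleSum A k (if Even k then i else j)) := by
      intro i j
      by_cases hij : A i j = 0
      · simp [hD i j hij]
      · rw [log_sinkhornSeq_succ hA hσ k hij, mul_sub]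
    simp only [h, Finset.sum_sub_distrib, ih]
    rw [sub_eq_self]
    by_cases hk : Even k
    · simp [hk, ← Finset.sum_mul, hrow]
    · rw [Finset.sum_comm]
      simp [hk, ← Finset.sum_mul, hcol]

lemma IsLimitPoint.sum_mul_log {L : Matrix (Fin n) (Fin n) ℝ} (hL : IsLimitPoint A L)
    (hA : ∀ i j, 0 ≤ A i j) (hσ : IsMatchingPerm A σ)
    {D : Matrix (Fin n) (Fin n) ℝ} (hD : ∀ i j, L i j = 0 → D i j = 0)
    (hrow : ∀ i, ∑ j, D i j = 0) (hcol : ∀ j, ∑ i, D i j = 0) :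
    ∑ i, ∑ j, D i j * Real.log (L i j) = ∑ i, ∑ j, D i j * Real.log (A i j) := by
  have hDA : ∀ i j, A i j = 0 → D i j = 0 := fun i j h => hD i j (hL.eq_zero hA hσ h)
  obtain ⟨f, hf, hle, h⟩ := hL
  have ht : Tendsto (fun k => ∑ i, ∑ j, D i j * Real.log (sinkhornSeq A k i j)) f
      (𝓝 (∑ i, ∑ j, D i j * Real.log (L i j))) := by
    refine tendsto_finsetSum _ fun i _ => tendsto_finsetSum _ fun j _ => ?_
    by_cases hij : L i j = 0
    · simp [hD i j hij]
    · exact ((tendsto_entry h i j).log hij).const_mul _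
  simp only [sum_mul_log_sinkhornSeq hA hσ hDA hrow hcol] at ht
  exact tendsto_nhds_unique ht tendsto_const_nhds

end Iterates

/-! ### Uniqueness of the limit point, convergence and symmetry -/

lemma sub_mul_log_sub_log_pos {x y : ℝ} (hx : 0 < x) (hy : 0 < y) (h : x ≠ y) :
    0 < (x - y) * (Real.log x - Real.log y) := by
  rcases h.lt_or_gt with h | h
  · exact mul_pos_of_neg_of_neg (sub_neg.2 h) (sub_neg.2 (Real.log_lt_log hx h))
  · exact mul_pos (sub_pos.2 h) (sub_pos.2 (Real.log_lt_log hy h))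

/-- Strict monotonicity of the logarithm, as an injectivity criterion for nonnegative matrices of
the same zero pattern. -/
lemma eq_of_sum_mul_log_eq {L M : Matrix (Fin n) (Fin n) ℝ} (hL : ∀ i j, 0 ≤ L i j)
    (hM : SamePattern L M)
    (h : ∑ i, ∑ j, (L - M) i j * Real.log (L i j) = ∑ i, ∑ j, (L - M) i j * Real.log (M i j)) :
    L = M := by
  have hterm : ∀ i j, L i j ≠ M i j →
      0 < (L i j - M i j) * (Real.log (L i j) - Real.log (M i j)) := by
    intro i j hne
    have hL0 : L i j ≠ 0 := fun h0 => hne (h0.trans ((hM i j).2.2 h0).symm)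
    exact sub_mul_log_sub_log_pos (lt_of_le_of_ne (hL i j) hL0.symm)
      (lt_of_le_of_ne (hM i j).1 fun h0 => hL0 ((hM i j).2.1 h0.symm)) hne
  have hnn : ∀ i j, 0 ≤ (L i j - M i j) * (Real.log (L i j) - Real.log (M i j)) := by
    intro i j
    by_cases hne : L i j = M i j
    · simp [hne]
    · exact (hterm i j hne).le
  have h0 : ∑ i, ∑ j, (L i j - M i j) * (Real.log (L i j) - Real.log (M i j)) = 0 := by
    simp only [mul_sub, Finset.sum_sub_distrib]
    exact sub_eq_zero.2 h
  ext i j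
  by_contra hne
  have h1 := (Finset.sum_eq_zero_iff_of_nonneg fun i _ =>
    Finset.sum_nonneg fun j _ => hnn i j).1 h0 i (Finset.mem_univ i)
  have h2 := (Finset.sum_eq_zero_iff_of_nonneg fun j _ => hnn i j).1 h1 j (Finset.mem_univ j)
  exact (hterm i j hne).ne' h2

section Limit

variable {A L M : Matrix (Fin n) (Fin n) ℝ} {σ : Equiv.Perm (Fin n)}

lemma sum_row_sub_eq_zero (hL : L ∈ doublyStochastic ℝ (Fin n))
    (hM : M ∈ doublyStochastic ℝ (Fin n)) (i : Fin n) : ∑ j, (L - M) i j = 0 := by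
  simp [sum_row_of_mem_doublyStochastic hL, sum_row_of_mem_doublyStochastic hM]

lemma sum_col_sub_eq_zero (hL : L ∈ doublyStochastic ℝ (Fin n))
    (hM : M ∈ doublyStochastic ℝ (Fin n)) (j : Fin n) : ∑ i, (L - M) i j = 0 := by
  simp [sum_col_of_mem_doublyStochastic hL, sum_col_of_mem_doublyStochastic hM]

/-- For limit points `L` and `M`, the difference `L - M` has the same pairing with the entrywise
logarithm of `L` as with that of `M`, since both are the pairing with the logarithm of `A`. -/
lemma IsLimitPoint.unique (hL : IsLimitPoint A L) (hM : IsLimitPoint A M)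
    (hA : ∀ i j, 0 ≤ A i j) (hσ : IsMatchingPerm A σ) : L = M := by
  have hLd := hL.mem_doublyStochastic hA hσ
  have hMd := hM.mem_doublyStochastic hA hσ
  have hzero : ∀ i j, M i j = 0 ↔ L i j = 0 := fun i j =>
    not_iff_not.1 ((hM.ne_zero_iff hA hσ).trans (hL.ne_zero_iff hA hσ).symm)
  have hrow := sum_row_sub_eq_zero hLd hMd
  have hcol := sum_col_sub_eq_zero hLd hMd
  refine eq_of_sum_mul_log_eq (fun _ _ => nonneg_of_mem_doublyStochastic hLd)
    (fun i j => ⟨nonneg_of_mem_doublyStochastic hMd, hzero i j⟩) ?_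
  rw [hL.sum_mul_log hA hσ (fun i j h => ?_) hrow hcol,
    hM.sum_mul_log hA hσ (fun i j h => ?_) hrow hcol]
  · simp [h, (hzero i j).1 h]
  · simp [h, (hzero i j).2 h]

lemma IsMatchingPerm.symm (hsymm : A.IsSymm) (hσ : IsMatchingPerm A σ) :
    IsMatchingPerm A σ.symm := fun i => by
  simpa [hsymm.apply] using hσ (σ.symm i)

/-- If `D` is skew-symmetric and `B` is symmetric, then `D` pairs to zero with the entrywise
logarithm of `B`; hence `L - Lᵀ` pairs to zero with the logarithms of both `L` and `Lᵀ`. -/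
lemma IsLimitPoint.isSymm (hL : IsLimitPoint A L) (hA : ∀ i j, 0 ≤ A i j)
    (hsymm : A.IsSymm) (hσ : IsMatchingPerm A σ) : L.IsSymm := by
  have hLd := hL.mem_doublyStochastic hA hσ
  have hLd' : L.transpose ∈ doublyStochastic ℝ (Fin n) :=
    transpose_mem_doublyStochastic_iff.2 hLd
  have hne : ∀ i j, L i j ≠ 0 → L j i ≠ 0 := by
    intro i j h
    obtain ⟨τ, hτ, rfl⟩ := (hL.ne_zero_iff hA hσ).1 h
    exact (hL.ne_zero_iff hA hσ).2 ⟨τ.symm, hτ.symm hsymm, by simp⟩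
  have hzero : ∀ i j, L j i = 0 ↔ L i j = 0 := fun i j =>
    not_iff_not.1 ⟨hne j i, hne i j⟩
  have hskew : ∀ B : Matrix (Fin n) (Fin n) ℝ,
      ∑ i, ∑ j, (L - L.transpose) i j * Real.log (B j i) =
        -∑ i, ∑ j, (L - L.transpose) i j * Real.log (B i j) := by
    intro B
    rw [Finset.sum_comm, ← Finset.sum_neg_distrib]
    refine Finset.sum_congr rfl fun i _ => ?_
    rw [← Finset.sum_neg_distrib]
    refine Finset.sum_congr rfl fun j _ => ?_
    simp only [Matrix.sub_apply, Matrix.transpose_apply]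
    ring
  have hlogA : ∑ i, ∑ j, (L - L.transpose) i j * Real.log (A i j) = 0 := by
    have h := hskew A
    simp only [hsymm.apply] at h
    linarith
  have hlogL : ∑ i, ∑ j, (L - L.transpose) i j * Real.log (L i j) = 0 := by
    rw [hL.sum_mul_log hA hσ (fun i j h => ?_) (sum_row_sub_eq_zero hLd hLd')
      (sum_col_sub_eq_zero hLd hLd'), hlogA]
    simp [h, (hzero i j).2 h]
  refine (eq_of_sum_mul_log_eq (fun _ _ => nonneg_of_mem_doublyStochastic hLd)
    (fun i j => ⟨nonneg_of_mem_doublyStochastic hLd', hzero i j⟩) ?_).symm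
  have h := hskew L
  rw [hlogL, neg_zero] at h
  exact hlogL.trans h.symm

lemma exists_isLimitPoint_of_ultrafilter (hA : ∀ i j, 0 ≤ A i j) (hσ : IsMatchingPerm A σ)
    (f : Ultrafilter ℕ) (hf : (f : Filter ℕ) ≤ atTop) :
    ∃ L, Tendsto (sinkhornSeq A) f (𝓝 L) := by
  have hK : IsCompact (Set.univ.pi fun _ : Fin n => Set.univ.pi fun _ : Fin n =>
      Set.Icc (0 : ℝ) 1) :=
    isCompact_univ_pi fun _ => isCompact_univ_pi fun _ => isCompact_Icc
  obtain ⟨L, -, hL⟩ := hK.ultrafilter_le_nhds (f.map (sinkhornSeq A)) <| by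
    rw [le_principal_iff]
    refine hf ?_
    filter_upwards [eventually_ge_atTop 1] with k hk
    obtain ⟨k, rfl⟩ := Nat.exists_eq_add_of_le' hk
    exact fun i _ j _ => ⟨(samePattern_sinkhornSeq hA hσ _ i j).1,
      sinkhornSeq_succ_le_one hA hσ k i j⟩
  exact ⟨L, hL⟩

/-- The Sinkhorn-Knopp iteration started at a nonnegative matrix with support converges. -/
theorem tendsto_sinkhornSeq (hA : ∀ i j, 0 ≤ A i j) (hσ : IsMatchingPerm A σ) :
    Tendsto (sinkhornSeq A) atTop (𝓝 (SK A)) := by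
  obtain ⟨L, hL⟩ := exists_isLimitPoint_of_ultrafilter hA hσ (Ultrafilter.of atTop)
    (Ultrafilter.of_le _)
  have hlim : Tendsto (sinkhornSeq A) atTop (𝓝 L) := by
    rw [tendsto_iff_ultrafilter]
    intro f hf
    obtain ⟨M, hM⟩ := exists_isLimitPoint_of_ultrafilter hA hσ f hf
    have hLM : L = M := IsLimitPoint.unique ⟨_, inferInstance, Ultrafilter.of_le _, hL⟩
      ⟨_, inferInstance, hf, hM⟩ hA hσ
    exact hLM ▸ hM
  exact tendsto_nhds_limUnder ⟨L, hlim⟩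

end Limit

/-! ### The Laplacian of a symmetric doubly stochastic matrix -/

section Laplacian

variable {S : Matrix (Fin n) (Fin n) ℝ}

lemma dotProduct_two_smul_one_sub_mulVec (hS : S ∈ doublyStochastic ℝ (Fin n)) (x : Fin n → ℝ) :
    x ⬝ᵥ ((2 : ℝ) • (1 - S)).mulVec x = ∑ i, ∑ j, S i j * (x i - x j) ^ 2 := by
  have h1 : ∑ i, ∑ j, S i j * x i ^ 2 = ∑ i, x i ^ 2 := by
    simp [← Finset.sum_mul, sum_row_of_mem_doublyStochastic hS]
  have h2 : ∑ i, ∑ j, S i j * x j ^ 2 = ∑ i, x i ^ 2 := by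
    rw [Finset.sum_comm]
    simp [← Finset.sum_mul, sum_col_of_mem_doublyStochastic hS]
  have h3 : x ⬝ᵥ S.mulVec x = ∑ i, ∑ j, S i j * (x i * x j) := by
    simp only [dotProduct, Matrix.mulVec, Finset.mul_sum]
    exact Finset.sum_congr rfl fun i _ => Finset.sum_congr rfl fun j _ => by ring
  have h4 : x ⬝ᵥ x = ∑ i, x i ^ 2 := by simp [dotProduct, sq]
  have h5 : ∀ i j, S i j * (x i - x j) ^ 2 =
      S i j * x i ^ 2 + S i j * x j ^ 2 - 2 * (S i j * (x i * x j)) := fun i j => by ring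
  simp only [h5, Finset.sum_sub_distrib, Finset.sum_add_distrib, ← Finset.mul_sum, h1, h2, ← h3]
  rw [Matrix.smul_mulVec, Matrix.sub_mulVec, Matrix.one_mulVec, dotProduct_smul, dotProduct_sub,
    h4, smul_eq_mul]
  ring

lemma posSemidef_two_smul_one_sub (hS : S ∈ doublyStochastic ℝ (Fin n)) (hsymm : S.IsSymm) :
    ((2 : ℝ) • (1 - S)).PosSemidef := by
  refine Matrix.PosSemidef.of_dotProduct_mulVec_nonneg ?_ fun x => ?_
  · ext i j
    simp [Matrix.one_apply, hsymm.apply, eq_comm]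
  · rw [star_trivial, dotProduct_two_smul_one_sub_mulVec hS]
    exact Finset.sum_nonneg fun i _ => Finset.sum_nonneg fun j _ =>
      mul_nonneg (nonneg_of_mem_doublyStochastic hS) (sq_nonneg _)

lemma two_smul_one_sub_mulVec_one (hS : S ∈ doublyStochastic ℝ (Fin n)) :
    ((2 : ℝ) • (1 - S)).mulVec 1 = 0 := by
  rw [Matrix.smul_mulVec, Matrix.sub_mulVec, Matrix.one_mulVec,
    mulVec_one_of_mem_doublyStochastic hS, sub_self, smul_zero]

lemma ker_two_smul_one_sub (hS : S ∈ doublyStochastic ℝ (Fin n))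
    (hconn : (matrixGraph S).Connected) :
    LinearMap.ker ((2 : ℝ) • (1 - S)).mulVecLin = Submodule.span ℝ {(1 : Fin n → ℝ)} := by
  refine le_antisymm (fun x hx => ?_) ?_
  · rw [LinearMap.mem_ker, Matrix.mulVecLin_apply] at hx
    have hsum := dotProduct_two_smul_one_sub_mulVec hS x
    rw [hx, dotProduct_zero] at hsum
    have hnn : ∀ i j, 0 ≤ S i j * (x i - x j) ^ 2 := fun i j =>
      mul_nonneg (nonneg_of_mem_doublyStochastic hS) (sq_nonneg _)
    have hS0 : ∀ i j, S i j ≠ 0 → x i = x j := by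
      intro i j hij
      have h1 := (Finset.sum_eq_zero_iff_of_nonneg fun i _ =>
        Finset.sum_nonneg fun j _ => hnn i j).1 hsum.symm i (Finset.mem_univ i)
      have h2 := (Finset.sum_eq_zero_iff_of_nonneg fun j _ => hnn i j).1 h1 j (Finset.mem_univ j)
      exact sub_eq_zero.1 (pow_eq_zero_iff two_ne_zero |>.1 ((mul_eq_zero.1 h2).resolve_left hij))
    have hadj : ∀ i j, (matrixGraph S).Adj i j → x i = x j := by
      intro i j hij
      rw [matrixGraph, SimpleGraph.fromRel_adj] at hij
      exact hij.2.elim (hS0 i j) fun h => (hS0 j i h).symm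
    have hreach : ∀ i j, x i = x j := by
      intro i j
      obtain ⟨w⟩ := hconn.preconnected i j
      induction w with
      | nil => rfl
      | cons h _ ih => exact (hadj _ _ h).trans ih
    obtain ⟨i₀⟩ := hconn.nonempty
    refine Submodule.mem_span_singleton.2 ⟨x i₀, ?_⟩
    ext i
    simp [hreach i₀ i]
  · rw [Submodule.span_singleton_le_iff_mem, LinearMap.mem_ker, Matrix.mulVecLin_apply]
    exact two_smul_one_sub_mulVec_one hS

end Laplacian

end SinkhornSplitting

theorem theorem1 {n : ℕ} (A : Matrix (Fin n) (Fin n) ℝ)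
    (h01 : ∀ i j, A i j = 0 ∨ A i j = 1)
    (hsymm : A.IsSymm)
    (hdiag : ∀ i, A i i = 0)
    (hsupp : SinkhornSplitting.HasSupport A)
    (hconn : (SinkhornSplitting.matrixGraph (SinkhornSplitting.matchingPart A)).Connected) :
    Filter.Tendsto (SinkhornSplitting.sinkhornSeq A) Filter.atTop
        (nhds (SinkhornSplitting.SK A)) ∧
      SinkhornSplitting.SK A ∈ doublyStochastic ℝ (Fin n) ∧
      ∀ W Z : Matrix (Fin n) (Fin n) ℝ,
        W = (2 : ℝ) • (1 - SinkhornSplitting.SK A) →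
        Z = (2 : ℝ) • (1 - SinkhornSplitting.SK A) →
        SinkhornSplitting.SplittingConditions Z W ∧ SinkhornSplitting.Adheres A Z W := by
  have hA : ∀ i j, 0 ≤ A i j := fun i j => by rcases h01 i j with h | h <;> simp [h]
  obtain ⟨P, hP⟩ := hsupp
  obtain ⟨σ, hσ, -⟩ := SinkhornSplitting.exists_isMatchingPerm_of_isPerfectMatching hP
  have hlim := SinkhornSplitting.tendsto_sinkhornSeq hA hσ
  have hpt : SinkhornSplitting.IsLimitPoint A (SinkhornSplitting.SK A) :=
    ⟨atTop, inferInstance, le_rfl, hlim⟩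
  have hds := hpt.mem_doublyStochastic hA hσ
  have hpsd := SinkhornSplitting.posSemidef_two_smul_one_sub hds (hpt.isSymm hA hsymm hσ)
  have hgraph : SinkhornSplitting.matrixGraph (SinkhornSplitting.SK A) =
      SinkhornSplitting.matrixGraph (SinkhornSplitting.matchingPart A) := by
    ext i j
    simp only [SinkhornSplitting.matrixGraph, SimpleGraph.fromRel_adj, hpt.ne_zero_iff hA hσ,
      SinkhornSplitting.matchingPart_ne_zero_iff]
  rw [← hgraph] at hconn
  refine ⟨hlim, hds, ?_⟩
  rintro W Z rfl rfl
  refine ⟨⟨hpsd, hpsd, ?_, ?_, fun i => ?_, ?_⟩, fun i j hij h0 => ?_⟩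
  · rw [sub_self]
    exact Matrix.PosSemidef.zero
  · exact SinkhornSplitting.ker_two_smul_one_sub hds hconn
  · simp [hpt.eq_zero hA hσ (hdiag i)]
  · rw [SinkhornSplitting.two_smul_one_sub_mulVec_one hds, dotProduct_zero]
  · simp [Matrix.one_apply_ne hij, hpt.eq_zero hA hσ h0]
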